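/- **(The Perimeter of an Ellipse.)** Let $a\ge b>0$. Let $p$ be the perimeter (arc length) of an ellipse in the Euclidean plane with semi-axes $a$ and $b$, and let $e=\sqrt{a^2-b^2}/a$ be its eccentricity. Then $p$ is finite, both of the following series converge, and $$p=2\pi a\left\{1-\sum_{n=1}^{\infty}\frac{1}{2n-1}\left(\frac{1}{4^{n}}\binom{2n}{n}\right)^{2}e^{2n}\right\}=\pi(a+b)\sum_{n=0}^{\infty}\left(\frac{1}{4^{n}(2n-1)}\binom{2n}{n}\right)^{2}\left(\frac{a-b}{a+b}\right)^{2n}.$$ That is, $$p=2\pi a\left\{1-\frac{1}{2^2}e^2-\frac{1^2\cdot 3}{2^2\cdot 4^2}e^4-\frac{1^2\cdot 3^2\cdot 5}{2^2\cdot 4^2\cdot 6^2}e^6-\cdots\right\}$$ $$=\pi(a+b)\left\{1+\left(\frac12\right)^2\left(\frac{a-b}{a+b}\right)^2+\left(\frac{1\cdot1}{2\cdot4}\right)^2\left(\frac{a-b}{a+b}\right)^4+\left(\frac{1\cdot1\cdot3}{2\cdot4\cdot6}\right)^2\left(\frac{a-b}{a+b}\right)^6+\cdots\right\}.$$ -/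

import Mathlib

open Real

/-- An ellipse in the Euclidean plane, in arbitrary position: its centre, the orthonormal frame
of the directions of its major axis (index `0`) and of its minor axis (index `1`), and its
semi-axes `a ≥ b > 0`. Circles are included. -/
structure Ellipse where
  /-- the centre -/
  center : EuclideanSpace ℝ (Fin 2)
  /-- the directions of the two axes -/
  axes : OrthonormalBasis (Fin 2) ℝ (EuclideanSpace ℝ (Fin 2))
  /-- the semi-major axis -/
  a : ℝ
  /-- the semi-minor axis -/
  b : ℝ
  b_pos : 0 < b
  b_le_a : b ≤ a

namespace Ellipse

/-- The points of the ellipse: in the coordinates `x, y` with respect to the centre and the axes,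
the equation is `x² / a² + y² / b² = 1`. -/
def carrier (E : Ellipse) : Set (EuclideanSpace ℝ (Fin 2)) :=
  {p | (inner ℝ (E.axes 0) (p - E.center) / E.a) ^ 2
      + (inner ℝ (E.axes 1) (p - E.center) / E.b) ^ 2 = 1}

/-- The eccentricity: the distance from the centre to a focus, divided by the semi-major axis. -/
noncomputable def eccentricity (E : Ellipse) : ℝ :=
  √(E.a ^ 2 - E.b ^ 2) / E.a

/-- The parametrization `(a cos t, b sin t)` of the ellipse. -/
noncomputable def param (E : Ellipse) (t : ℝ) : EuclideanSpace ℝ (Fin 2) :=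
  E.center + (E.a * cos t) • E.axes 0 + (E.b * sin t) • E.axes 1

/-- The perimeter: the arc length (the supremum of the lengths of inscribed polygonal lines) of
the closed curve that runs through the ellipse once. -/
noncomputable def perimeter (E : Ellipse) : ENNReal :=
  eVariationOn E.param (Set.Icc 0 (2 * π))

theorem inner_param_zero (E : Ellipse) (t : ℝ) :
    inner ℝ (E.axes 0) (E.param t - E.center) = E.a * cos t := by
  have h1 : inner ℝ (E.axes 0) (E.axes 1) = (0 : ℝ) := by
    rw [E.axes.inner_eq_ite]; simp
  have h0 : inner ℝ (E.axes 0) (E.axes 0) = (1 : ℝ) := by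
    rw [E.axes.inner_eq_ite]; simp
  have : E.param t - E.center = (E.a * cos t) • E.axes 0 + (E.b * sin t) • E.axes 1 := by
    unfold param; abel
  rw [this, inner_add_right, inner_smul_right, inner_smul_right, h0, h1]
  ring

theorem inner_param_one (E : Ellipse) (t : ℝ) :
    inner ℝ (E.axes 1) (E.param t - E.center) = E.b * sin t := by
  have h1 : inner ℝ (E.axes 1) (E.axes 0) = (0 : ℝ) := by
    rw [E.axes.inner_eq_ite]; simp
  have h0 : inner ℝ (E.axes 1) (E.axes 1) = (1 : ℝ) := by
    rw [E.axes.inner_eq_ite]; simp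
  have : E.param t - E.center = (E.a * cos t) • E.axes 0 + (E.b * sin t) • E.axes 1 := by
    unfold param; abel
  rw [this, inner_add_right, inner_smul_right, inner_smul_right, h0, h1]
  ring

/-- The parametrization runs through the ellipse exactly once as `t` runs through `[0, 2π)`,
so that its arc length is the perimeter of the ellipse. -/
theorem param_bijOn (E : Ellipse) : Set.BijOn E.param (Set.Ico 0 (2 * π)) E.carrier := by
  have hb : E.b ≠ 0 := E.b_pos.ne'
  have ha : E.a ≠ 0 := (lt_of_lt_of_le E.b_pos E.b_le_a).ne'
  refine ⟨?_, ?_, ?_⟩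
  · intro t _
    change _ = _
    rw [inner_param_zero, inner_param_one, mul_div_cancel_left₀ _ ha, mul_div_cancel_left₀ _ hb]
    exact cos_sq_add_sin_sq t
  · intro s hs t ht hst
    have h0 := E.inner_param_zero s
    have h1 := E.inner_param_one s
    rw [hst, inner_param_zero] at h0
    rw [hst, inner_param_one] at h1
    have hang : (s : Real.Angle) = t :=
      Real.Angle.cos_sin_inj (mul_left_cancel₀ ha h0).symm (mul_left_cancel₀ hb h1).symm
    obtain ⟨k, hk⟩ := Real.Angle.angle_eq_iff_two_pi_dvd_sub.1 hang
    have hp := Real.two_pi_pos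
    have hk1 : (k : ℝ) < 1 := by
      by_contra hc
      push Not at hc
      nlinarith [hs.1, hs.2, ht.1, ht.2]
    have hk2 : (-1 : ℝ) < k := by
      by_contra hc
      push Not at hc
      nlinarith [hs.1, hs.2, ht.1, ht.2]
    have hk0 : k = 0 := by
      have h3 : k < 1 := by exact_mod_cast hk1
      have h4 : -1 < k := by exact_mod_cast hk2
      omega
    rw [hk0] at hk
    simp only [Int.cast_zero, mul_zero] at hk
    linarith
  · intro p hp
    change _ = _ at hp
    set x := inner ℝ (E.axes 0) (p - E.center) / E.a with hx
    set y := inner ℝ (E.axes 1) (p - E.center) / E.b with hy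
    have hn : ‖(⟨x, y⟩ : ℂ)‖ = 1 := by
      rw [Complex.norm_def, Complex.normSq_mk, ← sq, ← sq, hp, Real.sqrt_one]
    have hz : (⟨x, y⟩ : ℂ) ≠ 0 := by
      intro h; rw [h] at hn; simp at hn
    have hc : cos (Complex.arg ⟨x, y⟩) = x := by rw [Complex.cos_arg hz, hn, div_one]
    have hs : sin (Complex.arg ⟨x, y⟩) = y := by rw [Complex.sin_arg, hn, div_one]
    refine ⟨toIcoMod Real.two_pi_pos 0 (Complex.arg ⟨x, y⟩), ?_, ?_⟩
    · simpa using toIcoMod_mem_Ico Real.two_pi_pos 0 (Complex.arg ⟨x, y⟩)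
    · have hm : toIcoMod Real.two_pi_pos 0 (Complex.arg ⟨x, y⟩)
          = Complex.arg ⟨x, y⟩ - toIcoDiv Real.two_pi_pos 0 (Complex.arg ⟨x, y⟩) * (2 * π) := by
        rw [toIcoMod, zsmul_eq_mul]
      rw [param, hm, Real.cos_sub_int_mul_two_pi, Real.sin_sub_int_mul_two_pi, hc, hs, hx, hy,
        mul_div_cancel₀ _ ha, mul_div_cancel₀ _ hb]
      have hsum := E.axes.sum_repr' (p - E.center)
      rw [Fin.sum_univ_two] at hsum
      rw [add_assoc, hsum]
      abel

end Ellipse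

theorem edist_le_edist_primitive_norm_deriv {F : Type*} [NormedAddCommGroup F] [NormedSpace ℝ F]
    [CompleteSpace F] {f f' : ℝ → F} (hf : ∀ t, HasDerivAt f (f' t) t) (hf' : Continuous f')
    (c x y : ℝ) :
    edist (f x) (f y) ≤ edist (∫ t in c..x, ‖f' t‖) (∫ t in c..y, ‖f' t‖) := by
  have hi : ∀ u v, IntervalIntegrable f' MeasureTheory.volume u v := fun u v =>
    hf'.intervalIntegrable u v
  rw [edist_dist, edist_dist]
  apply ENNReal.ofReal_le_ofReal
  rw [dist_eq_norm, dist_eq_norm,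
    intervalIntegral.integral_interval_sub_left (hi c x).norm (hi c y).norm,
    ← intervalIntegral.integral_eq_sub_of_hasDerivAt (fun t _ => hf t) (hi y x), Real.norm_eq_abs]
  exact intervalIntegral.norm_integral_le_abs_integral_norm

theorem integral_norm_deriv_le_of_norm_sub_le {F : Type*} [NormedAddCommGroup F]
    [NormedSpace ℝ F] [CompleteSpace F] {f f' : ℝ → F} (hf : ∀ t, HasDerivAt f (f' t) t)
    (hf' : Continuous f') {x y ε : ℝ} (hxy : x ≤ y)
    (hε : ∀ t ∈ Set.Icc x y, ‖f' t - f' x‖ ≤ ε) :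
    ∫ t in x..y, ‖f' t‖ ≤ ‖f y - f x‖ + 2 * ε * (y - x) := by
  have h1 : ∫ t in x..y, ‖f' t‖ ≤ ∫ _ in x..y, (‖f' x‖ + ε) := by
    refine intervalIntegral.integral_mono_on hxy (hf'.norm.intervalIntegrable _ _) (by simp) ?_
    intro t ht
    have := norm_sub_norm_le (f' t) (f' x)
    linarith [hε t ht]
  have h2 : ‖∫ t in x..y, (f' t - f' x)‖ ≤ ε * |y - x| := by
    refine intervalIntegral.norm_integral_le_of_norm_le_const fun t ht => ?_
    rw [Set.uIoc_of_le hxy] at ht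
    exact hε t ⟨ht.1.le, ht.2⟩
  rw [intervalIntegral.integral_sub (hf'.intervalIntegrable _ _) (by simp),
    intervalIntegral.integral_eq_sub_of_hasDerivAt (fun t _ => hf t)
      (hf'.intervalIntegrable _ _), intervalIntegral.integral_const,
    abs_of_nonneg (sub_nonneg.2 hxy)] at h2
  rw [intervalIntegral.integral_const, smul_eq_mul] at h1
  have h3 : ‖(y - x) • f' x‖ = (y - x) * ‖f' x‖ := by
    rw [norm_smul, Real.norm_of_nonneg (sub_nonneg.2 hxy)]
  have h4 := norm_sub_norm_le ((y - x) • f' x) (f y - f x)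
  rw [norm_sub_rev _ (f y - f x)] at h4
  nlinarith

/-- The arc length of a continuously differentiable curve is the integral of its speed. -/
theorem eVariationOn_Icc_eq_ofReal_integral_norm_deriv {F : Type*} [NormedAddCommGroup F]
    [NormedSpace ℝ F] [CompleteSpace F] {f f' : ℝ → F} (hf : ∀ t, HasDerivAt f (f' t) t)
    (hf' : Continuous f') {a b : ℝ} (hab : a ≤ b) :
    eVariationOn f (Set.Icc a b) = ENNReal.ofReal (∫ t in a..b, ‖f' t‖) := by
  set V : ℝ → ℝ := fun x => ∫ t in a..x, ‖f' t‖ with hV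
  have hVsub : ∀ x y, V y - V x = ∫ t in x..y, ‖f' t‖ := fun x y =>
    intervalIntegral.integral_interval_sub_left (hf'.norm.intervalIntegrable _ _)
      (hf'.norm.intervalIntegrable _ _)
  have hVmono : Monotone V := fun x y hxy => sub_nonneg.1 <| by
    rw [hVsub]
    exact intervalIntegral.integral_nonneg hxy fun t _ => norm_nonneg _
  apply le_antisymm
  · have hle : eVariationOn f (Set.Icc a b) ≤ eVariationOn V (Set.Icc a b) := by
      refine iSup_le fun p => ?_
      refine le_trans (Finset.sum_le_sum fun i _ => ?_)
        (eVariationOn.sum_le (f := V) p.2.2.1 p.2.2.2)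
      exact edist_le_edist_primitive_norm_deriv hf hf' a _ _
    refine hle.trans (le_of_eq ?_)
    rw [← Set.inter_self (Set.Icc a b),
      (hVmono.monotoneOn _).eVariationOn_eq (Set.left_mem_Icc.2 hab) (Set.right_mem_Icc.2 hab),
      hVsub]
  · refine ENNReal.le_of_forall_pos_le_add fun ε hε _ => ?_
    obtain ⟨η, hη, hηε⟩ : ∃ η : ℝ, 0 < η ∧ 2 * η * (b - a) ≤ ε := by
      refine ⟨ε / (2 * (b - a + 1)), by have := sub_nonneg.2 hab; positivity, ?_⟩
      have : 0 < b - a + 1 := by linarith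
      have hε' : (0 : ℝ) < ε := hε
      rw [mul_div_assoc', div_mul_eq_mul_div, div_le_iff₀ (by positivity)]
      nlinarith
    obtain ⟨δ, hδ, hu⟩ := Metric.uniformContinuousOn_iff.1
      (isCompact_Icc.uniformContinuousOn_of_continuous (hf'.continuousOn (s := Set.Icc a b))) η hη
    obtain ⟨n, hn⟩ := exists_nat_gt ((b - a) / δ)
    have hn0 : (0 : ℝ) < n := lt_of_le_of_lt (div_nonneg (sub_nonneg.2 hab) hδ.le) hn
    set h : ℝ := (b - a) / n with hh
    have hh0 : 0 ≤ h := div_nonneg (sub_nonneg.2 hab) hn0.le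
    have hhδ : h < δ := by
      rw [hh, div_lt_iff₀ hn0]
      rwa [div_lt_iff₀ hδ, mul_comm] at hn
    have hnh : n * h = b - a := mul_div_cancel₀ _ hn0.ne'
    set u : ℕ → ℝ := fun k => a + k * h with hudef
    have humono : Monotone u := fun i j hij => by
      have : (i : ℝ) ≤ j := by exact_mod_cast hij
      simp only [hudef]
      nlinarith
    have humem : ∀ k ≤ n, u k ∈ Set.Icc a b := fun k hk => by
      have h0 : u 0 = a := by simp [hudef]
      have h1 : u n = b := by simp [hudef, hnh]
      exact ⟨h0 ▸ humono (Nat.zero_le k), h1 ▸ humono hk⟩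
    have hstep : ∀ k, u (k + 1) - u k = h := fun k => by
      simp only [hudef]
      push_cast
      ring
    have hk : ∀ k ∈ Finset.range n,
        V (u (k + 1)) - V (u k) ≤ ‖f (u (k + 1)) - f (u k)‖ + 2 * η * h := fun k hk => by
      rw [hVsub, ← hstep k]
      refine integral_norm_deriv_le_of_norm_sub_le hf hf' (humono k.le_succ) fun t ht => ?_
      have hkn := Finset.mem_range.1 hk
      rw [← dist_eq_norm]
      refine (hu t ⟨(humem k hkn.le).1.trans ht.1, ht.2.trans (humem (k + 1) hkn).2⟩ _
        (humem k hkn.le) ?_).le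
      rw [Real.dist_eq, abs_of_nonneg (sub_nonneg.2 ht.1)]
      linarith [ht.2, hstep k]
    have hsum := Finset.sum_le_sum hk
    rw [Finset.sum_range_sub (fun k => V (u k)), Finset.sum_add_distrib, Finset.sum_const,
      Finset.card_range, nsmul_eq_mul, hVsub] at hsum
    have hu0 : u 0 = a := by simp [hudef]
    have hun : u n = b := by simp [hudef, hnh]
    rw [hu0, hun] at hsum
    have hvar : ENNReal.ofReal (∑ k ∈ Finset.range n, ‖f (u (k + 1)) - f (u k)‖) ≤
        eVariationOn f (Set.Icc a b) := by
      rw [ENNReal.ofReal_sum_of_nonneg fun _ _ => norm_nonneg _, Finset.range_eq_Ico]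
      refine le_trans (le_of_eq (Finset.sum_congr rfl fun k _ => ?_))
        (eVariationOn.sum_le_of_monotoneOn_Icc (f := f) (s := Set.Icc a b) (m := 0) (n := n)
          (humono.monotoneOn _) fun k hk => humem k hk.2)
      rw [edist_dist, dist_eq_norm]
    calc ENNReal.ofReal (∫ t in a..b, ‖f' t‖)
        ≤ ENNReal.ofReal ((∑ k ∈ Finset.range n, ‖f (u (k + 1)) - f (u k)‖) + ε) := by
          apply ENNReal.ofReal_le_ofReal
          have : (n : ℝ) * (2 * η * h) = 2 * η * (b - a) := by rw [← hnh]; ring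
          linarith
      _ ≤ _ := by
          rw [ENNReal.ofReal_add (q := (ε : ℝ)) (Finset.sum_nonneg fun _ _ => norm_nonneg _) ε.2,
            ENNReal.ofReal_coe_nnreal]
          gcongr

/-- The coefficient of `z ^ n` in the power series of `-√(1 - z)`. -/
noncomputable def negSqrtOneSubCoeff (n : ℕ) : ℝ :=
  ((2 * n).choose n : ℝ) / (4 ^ n * (2 * (n : ℝ) - 1))

theorem two_mul_natCast_sub_one_ne_zero (n : ℕ) : (2 * (n : ℝ) - 1) ≠ 0 := by
  intro h
  have : ((2 * n : ℕ) : ℝ) = (1 : ℕ) := by push_cast; linarith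
  have := Nat.cast_injective this
  omega

theorem succ_mul_choose_two_mul_succ (n : ℕ) :
    ((n : ℝ) + 1) * ((2 * (n + 1)).choose (n + 1) : ℝ) =
      2 * (2 * n + 1) * ((2 * n).choose n : ℝ) := by
  have := Nat.succ_mul_centralBinom_succ n
  rw [Nat.centralBinom_eq_two_mul_choose, Nat.centralBinom_eq_two_mul_choose] at this
  exact_mod_cast this

theorem negSqrtOneSubCoeff_zero : negSqrtOneSubCoeff 0 = -1 := by
  simp [negSqrtOneSubCoeff]

theorem succ_mul_negSqrtOneSubCoeff_succ (n : ℕ) :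
    ((n : ℝ) + 1) * negSqrtOneSubCoeff (n + 1) = (n - 1 / 2) * negSqrtOneSubCoeff n := by
  have h := succ_mul_choose_two_mul_succ n
  have h1 := two_mul_natCast_sub_one_ne_zero n
  have h2 : (2 * (n : ℝ) + 1) ≠ 0 := by positivity
  have h3 : (2 * ((n : ℝ) + 1) - 1) = 2 * n + 1 := by ring
  unfold negSqrtOneSubCoeff
  push_cast
  rw [h3, pow_succ, ← mul_div_assoc, h]
  field_simp
  ring

theorem abs_negSqrtOneSubCoeff_le_one (n : ℕ) : |negSqrtOneSubCoeff n| ≤ 1 := by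
  induction n with
  | zero => simp [negSqrtOneSubCoeff_zero]
  | succ n ih =>
    have hn : (0 : ℝ) < n + 1 := by positivity
    have h := congrArg abs (succ_mul_negSqrtOneSubCoeff_succ n)
    rw [abs_mul, abs_mul, abs_of_pos hn] at h
    have h1 : |(n : ℝ) - 1 / 2| ≤ n + 1 := by
      rw [abs_le]
      constructor <;> linarith
    have h2 : ((n : ℝ) + 1) * |negSqrtOneSubCoeff (n + 1)| ≤ (n + 1) * 1 := by
      rw [h]
      exact mul_le_mul h1 ih (abs_nonneg _) hn.le
    exact le_of_mul_le_mul_left h2 hn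

theorem succ_mul_ringChoose_succ (a : ℂ) (n : ℕ) :
    ((n : ℂ) + 1) * Ring.choose a (n + 1) = (a - n) * Ring.choose a n := by
  rw [Ring.choose_eq_smul, Ring.choose_eq_smul, descPochhammer_succ_right, Polynomial.smeval_mul,
    Polynomial.smeval_sub, Polynomial.smeval_X, Polynomial.smeval_natCast, Nat.factorial_succ]
  have : (n.factorial : ℂ) ≠ 0 := by exact_mod_cast n.factorial_ne_zero
  have : (n : ℂ) + 1 ≠ 0 := by exact_mod_cast n.succ_ne_zero
  push_cast
  simp only [smul_eq_mul, pow_one, pow_zero, nsmul_eq_mul, mul_one]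
  field_simp

theorem ringChoose_one_half_mul_neg_one_pow (n : ℕ) :
    Ring.choose (1 / 2 : ℂ) n * (-1) ^ n = -(negSqrtOneSubCoeff n : ℂ) := by
  induction n with
  | zero => simp [negSqrtOneSubCoeff_zero]
  | succ n ih =>
    have hn : (n : ℂ) + 1 ≠ 0 := by exact_mod_cast n.succ_ne_zero
    apply mul_left_cancel₀ hn
    have h := congrArg ((↑) : ℝ → ℂ) (succ_mul_negSqrtOneSubCoeff_succ n)
    push_cast at h
    rw [mul_neg, h, ← mul_assoc, succ_mul_ringChoose_succ, pow_succ]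
    linear_combination ((n : ℂ) - 1 / 2) * ih

theorem hasSum_negSqrtOneSubCoeff_mul_pow {z : ℂ} (hz : ‖z‖ < 1) :
    HasSum (fun n => (negSqrtOneSubCoeff n : ℂ) * z ^ n) (-(1 - z) ^ ((1 / 2 : ℝ) : ℂ)) := by
  have h := (Complex.one_add_cpow_hasFPowerSeriesOnBall_zero (a := 1 / 2)).hasSum (y := -z)
    (by simpa [enorm_eq_nnnorm, ← NNReal.coe_lt_one] using hz)
  convert! h.neg using 1
  · funext n
    simp only [binomialSeries_apply, List.ofFn_const, List.prod_replicate, smul_eq_mul]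
    rw [neg_pow, ← mul_assoc, ringChoose_one_half_mul_neg_one_pow]
    ring
  · norm_num [sub_eq_add_neg]

theorem hasSum_negSqrtOneSubCoeff_mul_pow_real {x : ℝ} (hx0 : 0 ≤ x) (hx : x < 1) :
    HasSum (fun n => negSqrtOneSubCoeff n * x ^ n) (-√(1 - x)) := by
  have h := hasSum_negSqrtOneSubCoeff_mul_pow (z := x) (by simpa [abs_of_nonneg hx0] using hx)
  have h1 : (0 : ℝ) ≤ 1 - x := by linarith
  rw [← Complex.ofReal_one, ← Complex.ofReal_sub, ← Complex.ofReal_cpow h1,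
    ← Real.sqrt_eq_rpow] at h
  exact_mod_cast h

theorem summable_abs_negSqrtOneSubCoeff_mul_pow {x : ℝ} (hx0 : 0 ≤ x) (hx : x < 1) :
    Summable fun n => |negSqrtOneSubCoeff n| * x ^ n := by
  refine Summable.of_nonneg_of_le (fun n => by positivity) (fun n => ?_)
    (summable_geometric_of_lt_one hx0 hx)
  exact mul_le_of_le_one_left (by positivity) (abs_negSqrtOneSubCoeff_le_one n)

theorem integral_cos_pow_two_mul (n : ℕ) :
    ∫ t in (0 : ℝ)..(2 * π), cos t ^ (2 * n) = 2 * π * (((2 * n).choose n : ℝ) / 4 ^ n) := by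
  induction n with
  | zero => simp
  | succ n ih =>
    rw [mul_add, mul_one, integral_cos_pow, ih]
    have h := succ_mul_choose_two_mul_succ n
    rw [mul_add, mul_one] at h
    have hn : (n : ℝ) + 1 ≠ 0 := by positivity
    rw [eq_div_of_mul_eq hn ((mul_comm _ _).trans h), sin_two_pi, sin_zero, pow_succ]
    push_cast
    field_simp
    ring

theorem integral_hasSum_of_norm_le {ι F : Type*} [Countable ι] [NormedAddCommGroup F]
    [NormedSpace ℝ F] {f : ι → ℝ → F} {g : ℝ → F} {B : ι → ℝ} (a b : ℝ)
    (hf : ∀ i, Continuous (f i)) (hB : Summable B) (hfB : ∀ i t, ‖f i t‖ ≤ B i)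
    (hg : ∀ t, HasSum (fun i => f i t) (g t)) :
    HasSum (fun i => ∫ t in a..b, f i t) (∫ t in a..b, g t) :=
  intervalIntegral.hasSum_integral_of_dominated_convergence (fun i _ => B i)
    (fun i => (hf i).aestronglyMeasurable) (fun i => .of_forall fun t _ => hfB i t)
    (.of_forall fun _ _ => hB) (by simp) (.of_forall fun t _ => hg t)

theorem hasSum_integral_sqrt_one_sub_mul_cos_sq {x : ℝ} (hx0 : 0 ≤ x) (hx : x < 1) :
    HasSum (fun n => negSqrtOneSubCoeff n * (((2 * n).choose n : ℝ) / 4 ^ n) * x ^ n)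
      (-(∫ t in (0 : ℝ)..(2 * π), √(1 - x * cos t ^ 2)) / (2 * π)) := by
  have key := integral_hasSum_of_norm_le 0 (2 * π)
    (f := fun n t => negSqrtOneSubCoeff n * (x * cos t ^ 2) ^ n)
    (g := fun t => -√(1 - x * cos t ^ 2)) (fun n => by fun_prop)
    (summable_abs_negSqrtOneSubCoeff_mul_pow hx0 hx)
    (fun n t => by
      rw [norm_mul, Real.norm_eq_abs, Real.norm_of_nonneg (by positivity)]
      gcongr
      exact mul_le_of_le_one_right hx0 (cos_sq_le_one t))
    (fun t => hasSum_negSqrtOneSubCoeff_mul_pow_real (by positivity)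
      (lt_of_le_of_lt (mul_le_of_le_one_right hx0 (cos_sq_le_one t)) hx))
  rw [intervalIntegral.integral_neg] at key
  convert! key.div_const (2 * π) using 1
  funext n
  simp_rw [mul_pow, ← pow_mul, ← mul_assoc]
  rw [intervalIntegral.integral_const_mul, integral_cos_pow_two_mul]
  have := Real.pi_ne_zero
  field_simp

theorem integral_exp_two_mul_pow_mul_conj_pow (m n : ℕ) :
    ∫ t in (0 : ℝ)..(2 * π), Complex.exp (2 * t * Complex.I) ^ m *
      (starRingEnd ℂ) (Complex.exp (2 * t * Complex.I)) ^ n = if m = n then 2 * (π : ℂ) else 0 := by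
  have h : ∀ t : ℝ, Complex.exp (2 * t * Complex.I) ^ m *
      (starRingEnd ℂ) (Complex.exp (2 * t * Complex.I)) ^ n =
        Complex.exp ((2 * ((m : ℂ) - n) * Complex.I) * t) := fun t => by
    rw [← Complex.exp_conj, ← Complex.exp_nat_mul, ← Complex.exp_nat_mul, ← Complex.exp_add]
    congr 1
    simp [Complex.conj_ofNat]
    ring
  simp_rw [h]
  split_ifs with hmn
  · simp [hmn]
  · have hc : (2 * ((m : ℂ) - n) * Complex.I) ≠ 0 := by
      have : (m : ℂ) - n ≠ 0 := sub_ne_zero.2 (by exact_mod_cast hmn)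
      simp [this]
    rw [integral_exp_mul_complex hc]
    have : Complex.exp (2 * ((m : ℂ) - n) * Complex.I * (2 * π : ℝ)) = 1 := by
      rw [Complex.exp_eq_one_iff]
      exact ⟨2 * ((m : ℤ) - n), by push_cast; ring⟩
    rw [this]
    simp

theorem hasSum_prod_mul_of_summable_norm {f g : ℕ → ℂ} {w v : ℂ} (hf : HasSum f w)
    (hg : HasSum g v) (hfn : Summable fun n => ‖f n‖) (hgn : Summable fun n => ‖g n‖) :
    HasSum (fun p : ℕ × ℕ => f p.1 * g p.2) (w * v) :=
  hf.mul hg (summable_mul_of_summable_norm hfn hgn)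

theorem hasSum_mul_conj_of_summable_norm {f : ℕ → ℂ} {w : ℂ} (hf : HasSum f w)
    (hn : Summable fun n => ‖f n‖) :
    HasSum (fun p : ℕ × ℕ => f p.1 * (starRingEnd ℂ) (f p.2)) ((‖w‖ ^ 2 : ℝ) : ℂ) := by
  have hn' : Summable fun n => ‖(starRingEnd ℂ) (f n)‖ := by
    simpa only [RCLike.norm_conj] using hn
  have hconj : HasSum (fun n => (starRingEnd ℂ) (f n)) ((starRingEnd ℂ) w) :=
    Complex.hasSum_conj'.2 hf
  rw [← Complex.normSq_eq_norm_sq, Complex.normSq_eq_conj_mul_self, mul_comm]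
  exact hasSum_prod_mul_of_summable_norm (g := fun n => (starRingEnd ℂ) (f n)) hf hconj hn hn'

/-- Parseval's identity for an absolutely convergent power series on the unit circle. -/
theorem hasSum_norm_sq_coeff_integral_norm_sq {c : ℕ → ℂ} (hc : Summable fun n => ‖c n‖)
    {g : ℝ → ℂ} (hg : ∀ t : ℝ, HasSum (fun n => c n * Complex.exp (2 * t * Complex.I) ^ n) (g t)) :
    HasSum (fun n => ‖c n‖ ^ 2) ((∫ t in (0 : ℝ)..(2 * π), ‖g t‖ ^ 2) / (2 * π)) := by
  have hun : ∀ t : ℝ, ‖Complex.exp (2 * t * Complex.I)‖ = 1 := fun t => by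
    have := Complex.norm_exp_ofReal_mul_I (2 * t)
    push_cast at this
    exact this
  have hsum : ∀ t : ℝ, HasSum (fun p : ℕ × ℕ =>
      (c p.1 * Complex.exp (2 * t * Complex.I) ^ p.1) *
        (starRingEnd ℂ) (c p.2 * Complex.exp (2 * t * Complex.I) ^ p.2))
        ((‖g t‖ ^ 2 : ℝ) : ℂ) := by
    intro t
    have hcs : Summable fun n => ‖c n * Complex.exp (2 * t * Complex.I) ^ n‖ := by
      simpa only [norm_mul, norm_pow, hun, one_pow, mul_one] using hc
    exact hasSum_mul_conj_of_summable_norm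
      (f := fun n => c n * Complex.exp (2 * t * Complex.I) ^ n) (hg t) hcs
  have hterm : ∀ n, Continuous fun t : ℝ => c n * Complex.exp (2 * t * Complex.I) ^ n :=
    fun n => by fun_prop
  have hcont : ∀ p : ℕ × ℕ, Continuous fun t : ℝ =>
      (c p.1 * Complex.exp (2 * t * Complex.I) ^ p.1) *
        (starRingEnd ℂ) (c p.2 * Complex.exp (2 * t * Complex.I) ^ p.2) :=
    fun p => (hterm p.1).mul (Complex.continuous_conj.comp (hterm p.2))
  have hB : Summable fun p : ℕ × ℕ => ‖c p.1‖ * ‖c p.2‖ :=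
    hc.mul_of_nonneg hc (fun _ => norm_nonneg _) (fun _ => norm_nonneg _)
  have hle : ∀ (p : ℕ × ℕ) (t : ℝ), ‖(c p.1 * Complex.exp (2 * t * Complex.I) ^ p.1) *
      (starRingEnd ℂ) (c p.2 * Complex.exp (2 * t * Complex.I) ^ p.2)‖ ≤ ‖c p.1‖ * ‖c p.2‖ :=
    fun p t => by
      rw [norm_mul, RCLike.norm_conj, norm_mul, norm_mul, norm_pow, norm_pow, hun, one_pow,
        one_pow, mul_one, mul_one]
  have key := integral_hasSum_of_norm_le 0 (2 * π) hcont hB hle hsum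
  have hint : ∀ p : ℕ × ℕ, (∫ t in (0 : ℝ)..(2 * π),
      (c p.1 * Complex.exp (2 * t * Complex.I) ^ p.1) *
        (starRingEnd ℂ) (c p.2 * Complex.exp (2 * t * Complex.I) ^ p.2)) =
        c p.1 * (starRingEnd ℂ) (c p.2) * if p.1 = p.2 then 2 * (π : ℂ) else 0 := fun p => by
    rw [← integral_exp_two_mul_pow_mul_conj_pow, ← intervalIntegral.integral_const_mul]
    congr 1
    funext t
    rw [map_mul, map_pow]
    ring
  simp only [hint] at key
  have hinj : Function.Injective fun n : ℕ => (n, n) := fun m n h => (Prod.ext_iff.1 h).1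
  rw [← hinj.hasSum_iff] at key
  · rw [intervalIntegral.integral_ofReal] at key
    have key' : HasSum (fun n => ‖c n‖ ^ 2 * (2 * π)) (∫ t in (0 : ℝ)..(2 * π), ‖g t‖ ^ 2) := by
      rw [← Complex.hasSum_ofReal]
      refine key.congr_fun fun n => ?_
      simp only [Function.comp_apply, if_true, Complex.mul_conj, Complex.normSq_eq_norm_sq]
      push_cast
      rfl
    refine (key'.div_const (2 * π)).congr_fun fun n => ?_
    rw [mul_div_cancel_right₀ _ Real.two_pi_pos.ne']
  · rintro ⟨m, n⟩ hmn
    have : m ≠ n := fun h => hmn ⟨m, by simp [h]⟩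
    simp [this]

theorem hasSum_integral_norm_one_sub_mul_exp {l : ℝ} (hl0 : 0 ≤ l) (hl : l < 1) :
    HasSum (fun n => negSqrtOneSubCoeff n ^ 2 * l ^ (2 * n))
      ((∫ t in (0 : ℝ)..(2 * π), ‖1 - l * Complex.exp (2 * t * Complex.I)‖) / (2 * π)) := by
  have hz : ∀ t : ℝ, ‖l * Complex.exp (2 * t * Complex.I)‖ < 1 := fun t => by
    have := Complex.norm_exp_ofReal_mul_I (2 * t)
    push_cast at this
    rwa [norm_mul, this, mul_one, Complex.norm_real, Real.norm_of_nonneg hl0]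
  have hcn : ∀ n, ‖(negSqrtOneSubCoeff n : ℂ) * (l : ℂ) ^ n‖ = |negSqrtOneSubCoeff n| * l ^ n :=
    fun n => by
      rw [norm_mul, norm_pow, Complex.norm_real, Complex.norm_real, Real.norm_of_nonneg hl0,
        Real.norm_eq_abs]
  have hcs : Summable fun n => ‖(negSqrtOneSubCoeff n : ℂ) * (l : ℂ) ^ n‖ := by
    simpa only [hcn] using summable_abs_negSqrtOneSubCoeff_mul_pow hl0 hl
  have key := hasSum_norm_sq_coeff_integral_norm_sq hcs fun t => by
    simpa only [mul_pow, ← mul_assoc] using hasSum_negSqrtOneSubCoeff_mul_pow (hz t)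
  simp only [hcn, mul_pow, sq_abs, ← pow_mul', norm_neg, Complex.norm_cpow_real,
    ← Real.sqrt_eq_rpow, Real.sq_sqrt (norm_nonneg _)] at key
  exact key

namespace Ellipse

/-- The velocity of the parametrization `Ellipse.param`. -/
noncomputable def velocity (E : Ellipse) (t : ℝ) : EuclideanSpace ℝ (Fin 2) :=
  (-(E.a * sin t)) • E.axes 0 + (E.b * cos t) • E.axes 1

theorem a_pos (E : Ellipse) : 0 < E.a := E.b_pos.trans_le E.b_le_a

theorem hasDerivAt_param (E : Ellipse) (t : ℝ) : HasDerivAt E.param (E.velocity t) t := by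
  have h1 : HasDerivAt (fun t => E.a * cos t) (-(E.a * sin t)) t := by
    simpa using (hasDerivAt_cos t).const_mul E.a
  have h2 : HasDerivAt (fun t => E.b * sin t) (E.b * cos t) t :=
    (hasDerivAt_sin t).const_mul E.b
  exact ((h1.smul_const (E.axes 0)).const_add E.center).add (h2.smul_const (E.axes 1))

theorem continuous_velocity (E : Ellipse) : Continuous E.velocity := by
  unfold velocity
  fun_prop

theorem norm_velocity_sq (E : Ellipse) (t : ℝ) :
    ‖E.velocity t‖ ^ 2 = E.a ^ 2 * sin t ^ 2 + E.b ^ 2 * cos t ^ 2 := by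
  have h01 : inner ℝ (E.axes 0) (E.axes 1) = (0 : ℝ) := by
    rw [E.axes.inner_eq_ite]; simp
  rw [velocity, norm_add_sq_real, inner_smul_left, inner_smul_right, h01, norm_smul, norm_smul,
    E.axes.norm_eq_one, E.axes.norm_eq_one]
  simp [mul_pow]

theorem eccentricity_sq (E : Ellipse) : E.eccentricity ^ 2 = (E.a ^ 2 - E.b ^ 2) / E.a ^ 2 := by
  rw [eccentricity, div_pow, Real.sq_sqrt]
  nlinarith [E.b_pos, E.b_le_a]

theorem eccentricity_sq_lt_one (E : Ellipse) : E.eccentricity ^ 2 < 1 := by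
  rw [eccentricity_sq, div_lt_one (pow_pos E.a_pos 2)]
  nlinarith [pow_pos E.b_pos 2]

theorem norm_velocity_eq_sqrt (E : Ellipse) (t : ℝ) :
    ‖E.velocity t‖ = E.a * √(1 - E.eccentricity ^ 2 * cos t ^ 2) := by
  have h : (0 : ℝ) ≤ 1 - E.eccentricity ^ 2 * cos t ^ 2 := by
    nlinarith [E.eccentricity_sq_lt_one, cos_sq_le_one t, sq_nonneg (cos t)]
  rw [← sq_eq_sq₀ (norm_nonneg _) (mul_nonneg E.a_pos.le (Real.sqrt_nonneg _)), mul_pow,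
    Real.sq_sqrt h, norm_velocity_sq, eccentricity_sq, sin_sq]
  have := E.a_pos.ne'
  field_simp
  ring

theorem norm_velocity_eq_norm_one_sub_mul_exp (E : Ellipse) (t : ℝ) :
    ‖E.velocity t‖ = (E.a + E.b) / 2 *
      ‖1 - ((E.a - E.b) / (E.a + E.b) : ℝ) * Complex.exp (2 * t * Complex.I)‖ := by
  have hab : 0 < E.a + E.b := add_pos E.a_pos E.b_pos
  rw [← sq_eq_sq₀ (norm_nonneg _) (by positivity), mul_pow, norm_velocity_sq,
    ← Complex.normSq_eq_norm_sq]
  have h : Complex.exp (2 * t * Complex.I) = (cos (2 * t) : ℝ) + (sin (2 * t) : ℝ) * Complex.I := by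
    rw [Complex.exp_mul_I]
    push_cast
    rfl
  rw [h, Complex.normSq_apply]
  simp only [Complex.sub_re, Complex.sub_im, Complex.one_re, Complex.one_im, Complex.mul_re,
    Complex.mul_im, Complex.add_re, Complex.add_im, Complex.ofReal_re, Complex.ofReal_im,
    Complex.I_re, Complex.I_im]
  have hs := sin_sq_add_cos_sq (2 * t)
  rw [sin_sq, cos_sq]
  field_simp
  linear_combination (-(E.a - E.b) ^ 2) * hs

theorem perimeter_eq_ofReal_integral_norm_velocity (E : Ellipse) :
    E.perimeter = ENNReal.ofReal (∫ t in (0 : ℝ)..(2 * π), ‖E.velocity t‖) :=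
  eVariationOn_Icc_eq_ofReal_integral_norm_deriv E.hasDerivAt_param E.continuous_velocity
    Real.two_pi_pos.le

theorem toReal_perimeter (E : Ellipse) :
    E.perimeter.toReal = ∫ t in (0 : ℝ)..(2 * π), ‖E.velocity t‖ := by
  rw [perimeter_eq_ofReal_integral_norm_velocity, ENNReal.toReal_ofReal]
  exact intervalIntegral.integral_nonneg Real.two_pi_pos.le fun t _ => norm_nonneg _

/-- Maclaurin's series for the perimeter. -/
theorem hasSum_maclaurin (E : Ellipse) :
    HasSum (fun n : ℕ =>
      1 / (2 * ((n + 1 : ℕ) : ℝ) - 1) * (((2 * (n + 1)).choose (n + 1) : ℝ) / 4 ^ (n + 1)) ^ 2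
        * E.eccentricity ^ (2 * (n + 1))) (1 - E.perimeter.toReal / (2 * π * E.a)) := by
  have h := hasSum_integral_sqrt_one_sub_mul_cos_sq (sq_nonneg E.eccentricity)
    E.eccentricity_sq_lt_one
  rw [← hasSum_nat_add_iff' 1] at h
  have ha := E.a_pos.ne'
  have hpi := Real.pi_ne_zero
  have hp : E.perimeter.toReal =
      E.a * ∫ t in (0 : ℝ)..(2 * π), √(1 - E.eccentricity ^ 2 * cos t ^ 2) := by
    rw [toReal_perimeter, ← intervalIntegral.integral_const_mul]
    simp only [norm_velocity_eq_sqrt]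
  convert! h using 1
  · funext n
    have := two_mul_natCast_sub_one_ne_zero (n + 1)
    rw [negSqrtOneSubCoeff, ← pow_mul]
    field_simp
  · rw [hp]
    simp only [Finset.sum_range_one, negSqrtOneSubCoeff_zero]
    simp
    field_simp
    ring

/-- Ivory's series for the perimeter. -/
theorem hasSum_ivory (E : Ellipse) :
    HasSum (fun n : ℕ =>
      (((2 * n).choose n : ℝ) / (4 ^ n * (2 * (n : ℝ) - 1))) ^ 2
        * ((E.a - E.b) / (E.a + E.b)) ^ (2 * n))
      (E.perimeter.toReal / (π * (E.a + E.b))) := by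
  have hab : 0 < E.a + E.b := add_pos E.a_pos E.b_pos
  have h := hasSum_integral_norm_one_sub_mul_exp (l := (E.a - E.b) / (E.a + E.b))
    (div_nonneg (sub_nonneg.2 E.b_le_a) hab.le)
    ((div_lt_one hab).2 (by linarith [E.b_pos]))
  convert! h using 1
  rw [toReal_perimeter]
  simp only [norm_velocity_eq_norm_one_sub_mul_exp]
  rw [intervalIntegral.integral_const_mul]
  generalize (∫ t in (0 : ℝ)..(2 * π), ‖1 - ((E.a - E.b) / (E.a + E.b) : ℝ) *
    Complex.exp (2 * t * Complex.I)‖) = s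
  have hpi := Real.pi_ne_zero
  field_simp

end Ellipse

theorem theorem2 (E : Ellipse) :
    -- both series converge
    Summable (fun n : ℕ =>
      1 / (2 * ((n + 1 : ℕ) : ℝ) - 1) * (((2 * (n + 1)).choose (n + 1) : ℝ) / 4 ^ (n + 1)) ^ 2
        * E.eccentricity ^ (2 * (n + 1))) ∧
    Summable (fun n : ℕ =>
      (((2 * n).choose n : ℝ) / (4 ^ n * (2 * (n : ℝ) - 1))) ^ 2
        * ((E.a - E.b) / (E.a + E.b)) ^ (2 * n)) ∧
    -- the perimeter is finite, and is given by Maclaurin's series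
    E.perimeter ≠ ⊤ ∧
    E.perimeter.toReal =
      2 * π * E.a * (1 - ∑' n : ℕ,
        1 / (2 * ((n + 1 : ℕ) : ℝ) - 1) * (((2 * (n + 1)).choose (n + 1) : ℝ) / 4 ^ (n + 1)) ^ 2
          * E.eccentricity ^ (2 * (n + 1))) ∧
    -- and by Ivory's series
    E.perimeter.toReal =
      π * (E.a + E.b) * ∑' n : ℕ,
        (((2 * n).choose n : ℝ) / (4 ^ n * (2 * (n : ℝ) - 1))) ^ 2
          * ((E.a - E.b) / (E.a + E.b)) ^ (2 * n) := by
  have hab : 0 < E.a + E.b := add_pos E.a_pos E.b_pos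
  have ha := E.a_pos
  have hpi := Real.pi_pos
  refine ⟨E.hasSum_maclaurin.summable, E.hasSum_ivory.summable, ?_, ?_, ?_⟩
  · rw [E.perimeter_eq_ofReal_integral_norm_velocity]
    exact ENNReal.ofReal_ne_top
  · rw [E.hasSum_maclaurin.tsum_eq]
    field_simp
    ring
  · rw [E.hasSum_ivory.tsum_eq]
    field_simp
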